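/- Let $\mathbb C$ be a regular category: it has finite limits, every morphism factors as a regular epimorphism followed by a monomorphism, and regular epimorphisms are stable under pullback. A relation $R$ from $X$ to $Y$ in $\mathbb C$ is a subobject $\langle r_1,r_2\rangle\colon R\rightarrowtail X\times Y$; its opposite $R^\circ$ is the relation $\langle r_2,r_1\rangle\colon R\rightarrowtail Y\times X$; for a relation $S$ from $Y$ to $Z$, the composite $SR$ is the relation from $X$ to $Z$ given by the image of $\langle r_1\pi_1,s_2\pi_2\rangle\colon R\times_Y S\to X\times Z$. For generalised elements $x\colon A\to X$, $y\colon A\to Y$, we write $(x,y)\in R$ when $\langle x,y\rangle\colon A\to X\times Y$ factors through $R$. A relation $R$ on $X$ (i.e. from $X$ to $X$) is reflexive if $1_X\leqslant R$, where $1_X$ is the diagonal of $X$, and an equivalence relation if moreover $R^\circ\leqslant R$ and $RR\leqslant R$. The category $\mathbb C$ is a Goursat category if $RSR=SRS$ for all equivalence relations $R$, $S$ on the same object. For relations $R,S,T$ on $X$ and generalised elements $x,y,u,v\colon A\to X$, the Shifting Lemma for $(R,S,T)$ at $(x,y,u,v)$ is the assertion: if $R\wedge S\leqslant T$, $(x,y)\in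 R\wedge T$, $(x,u)\in S$, $(y,v)\in S$ and $(u,v)\in R$, then $(u,v)\in T$. The following conditions are equivalent: 1. $\mathbb C$ is a Goursat category; 2. for every reflexive relation $E$ on any object $X$ of $\mathbb C$ and all generalised elements $z,x,y\colon A\to X$, the Shifting Lemma holds for $R=EE^\circ$, $S=E$, $T=E^\circ E$ at $(z,z,x,y)$, that is, in the diagram with top row $z\,E\,x$, bottom row $z\,E\,y$, left column from $z$ to $z$ and right column from $x$ to $y$; 3. for every reflexive relation $E$ on any object $X$ of $\mathbb C$, the Shifting Lemma holds for $R=EE^\circ$, $S=E$, $T=E^\circ E$ at all generalised elements $x,y,u,v\colon A\to X$. -/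

import Mathlib

open CategoryTheory CategoryTheory.Limits

universe v u

noncomputable section

namespace RegularRel

variable {C : Type u} [Category.{v} C] [Regular C]

/-- An internal relation from `X` to `Y`: a subobject of `X ⨯ Y`. -/
abbrev IRel (X Y : C) : Type (max u v) := Subobject (X ⨯ Y)

/-- First leg `r₁` of a relation `⟨r₁, r₂⟩ : R ⟶ X ⨯ Y`. -/
def leg₁ {X Y : C} (R : IRel X Y) : (R : C) ⟶ X := R.arrow ≫ prod.fst

/-- Second leg `r₂` of a relation `⟨r₁, r₂⟩ : R ⟶ X ⨯ Y`. -/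
def leg₂ {X Y : C} (R : IRel X Y) : (R : C) ⟶ Y := R.arrow ≫ prod.snd

instance mono_lift_leg₂_leg₁ {X Y : C} (R : IRel X Y) :
    Mono (prod.lift (leg₂ R) (leg₁ R)) := by
  have h : prod.lift (leg₂ R) (leg₁ R) = R.arrow ≫ (prod.braiding X Y).hom := by
    ext <;> simp [leg₁, leg₂]
  rw [h]
  infer_instance

/-- The generalised element `(x, y) : A ⟶ X ⨯ Y` belongs to the relation `R`. -/
def Mem {X Y A : C} (R : IRel X Y) (x : A ⟶ X) (y : A ⟶ Y) : Prop :=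
  R.Factors (prod.lift x y)

/-- The opposite relation `R°`, given by `⟨r₂, r₁⟩`. -/
def opp {X Y : C} (R : IRel X Y) : IRel Y X :=
  Subobject.mk (prod.lift (leg₂ R) (leg₁ R))

/-- The relational composite `S R` (first `R`, then `S`): the image of
`⟨r₁ π₁, s₂ π₂⟩ : R ×_Y S ⟶ X ⨯ Z`. In a regular category the image factorisation is the
factorisation as a regular epimorphism followed by a monomorphism. -/
def comp {X Y Z : C} (S : IRel Y Z) (R : IRel X Y) : IRel X Z :=
  imageSubobject
    (prod.lift (pullback.fst (leg₂ R) (leg₁ S) ≫ leg₁ R)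
      (pullback.snd (leg₂ R) (leg₁ S) ≫ leg₂ S))

/-- `1_X ≤ R`, where `1_X` is the diagonal. -/
def IsRefl {X : C} (R : IRel X X) : Prop := Subobject.mk (diag X) ≤ R

/-- `R° ≤ R`. -/
def IsSymm {X : C} (R : IRel X X) : Prop := opp R ≤ R

/-- `R R ≤ R`. -/
def IsTrans {X : C} (R : IRel X X) : Prop := comp R R ≤ R

/-- Internal equivalence relations. -/
structure IsEquivRel {X : C} (R : IRel X X) : Prop where
  refl : IsRefl R
  symm : IsSymm R
  trans : IsTrans R

variable (C) in
/-- A regular category is Goursat when it is 3-permutable: `R S R = S R S` for all equivalence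
relations `R`, `S` on the same object. -/
def IsGoursat : Prop :=
  ∀ (X : C) (R S : IRel X X), IsEquivRel R → IsEquivRel S →
    comp R (comp S R) = comp S (comp R S)

/-- The Shifting Lemma for the relations `R`, `S`, `T` on `X` at the quadrilateral with top row
`x S u`, bottom row `y S v`, left column `x (R ∧ T) y` and right column `u R v`: if `R ∧ S ≤ T`,
then `u T v`. Relations are read from left to right and from top to bottom, and `x, y, u, v` are
generalised elements of `X`. -/
def ShiftingAt {X A : C} (R S T : IRel X X) (x y u v : A ⟶ X) : Prop :=
  R ⊓ S ≤ T → Mem (R ⊓ T) x y → Mem S x u → Mem S y v → Mem R u v → Mem T u v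

variable (C) in
/-- The Shifting Lemma holds for `R = E E°`, `S = E`, `T = E° E`, with `E` any reflexive relation,
and for all quadrilaterals `x, y, u, v`. -/
def ShiftingForRefl : Prop :=
  ∀ (X : C) (E : IRel X X), IsRefl E → ∀ (A : C) (x y u v : A ⟶ X),
    ShiftingAt (comp E (opp E)) E (comp (opp E) E) x y u v

variable (C) in
/-- The Shifting Lemma holds for `R = E E°`, `S = E`, `T = E° E`, with `E` any reflexive relation,
and for the quadrilaterals with top row `z E x`, bottom row `z E y` (both left-hand vertices
equal to `z`). -/
def ShiftingForReflDiagram : Prop :=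
  ∀ (X : C) (E : IRel X X), IsRefl E → ∀ (A : C) (z x y : A ⟶ X),
    ShiftingAt (comp E (opp E)) E (comp (opp E) E) z z x y

end RegularRel

end

/-!
Relations are handled through their generalised elements, existential quantifiers being witnessed
on a regular epimorphic cover. All three conditions amount to the inequality `E E° ≤ E° E` for
reflexive relations `E`.

If `C` is Goursat, 3-permutability of the kernel pairs of the two legs of a relation `R` turns a
zigzag `x R a`, `y R a`, `y R b`, `z R b` into a single pair of steps `x R c`, `z R c`. When
`z E x` and `z E y` with `E` reflexive, the zigzag `x E x`, `z E x`, `z E y`, `y E y` gives the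
inequality. Conversely, for equivalence relations `R` and `S`, the inequality for `E = R S` reads
`R S R = R S S R ≤ S R R S = S R S`. Since `E ≤ E° E` when `E` is reflexive, the Shifting Lemma at
`(z, z, x, y)` is again this inequality.
-/

namespace RegularRel

section Factorisation

variable {D : Type u} [Category.{v} D] {A B X Y Z : D}

lemma prod_lift_eq_lift_iff [HasBinaryProduct X Y] {x x' : A ⟶ X} {y y' : A ⟶ Y} :
    prod.lift x y = prod.lift x' y' ↔ x = x' ∧ y = y' := by
  simp only [prod.hom_ext_iff, prod.lift_fst, prod.lift_snd]

lemma mk_factors_iff_exists {m : Z ⟶ X} [Mono m] {g : A ⟶ X} :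
    (Subobject.mk m).Factors g ↔ ∃ k : A ⟶ Z, k ≫ m = g :=
  Subobject.mk_factors_iff m g

lemma factors_of_strongEpi_comp {P : Subobject X} {g : A ⟶ X} (q : B ⟶ A) [StrongEpi q]
    (h : P.Factors (q ≫ g)) : P.Factors g := by
  have sq : CommSq (P.factorThru _ h) q P.arrow g := ⟨P.factorThru_arrow _ h⟩
  rw [← sq.fac_right]
  exact P.factors_comp_arrow _

end Factorisation

variable {C : Type u} [Category.{v} C] [Regular C] {X Y Z W A B : C}

lemma imageSubobject_factors_iff {f : X ⟶ Y} {g : A ⟶ Y} :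
    (imageSubobject f).Factors g ↔
      ∃ (B : C) (q : B ⟶ A) (_ : IsRegularEpi q) (k : B ⟶ X), k ≫ f = q ≫ g := by
  constructor
  · intro h
    obtain ⟨l, rfl⟩ : ∃ l, l ≫ image.ι f = g := mk_factors_iff_exists.mp h
    refine ⟨_, pullback.fst l (factorThruImage f), inferInstance, pullback.snd _ _, ?_⟩
    rw [pullback.condition_assoc, image.fac]
  · rintro ⟨B, q, _, k, hk⟩
    exact factors_of_strongEpi_comp q (hk ▸ imageSubobject_factors_comp_self f k)

section Membership

lemma lift_legs (R : IRel X Y) : prod.lift (leg₁ R) (leg₂ R) = R.arrow := by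
  rw [leg₁, leg₂, ← prod.comp_lift, prod.lift_fst_snd, Category.comp_id]

variable {R : IRel X Y} {x : A ⟶ X} {y : A ⟶ Y}

lemma mem_iff_exists : Mem R x y ↔ ∃ f : A ⟶ (R : C), f ≫ leg₁ R = x ∧ f ≫ leg₂ R = y := by
  simp only [← prod_lift_eq_lift_iff, ← prod.comp_lift, lift_legs]
  exact Subobject.factors_iff R _

lemma mem_precomp_legs (f : A ⟶ (R : C)) : Mem R (f ≫ leg₁ R) (f ≫ leg₂ R) :=
  mem_iff_exists.mpr ⟨f, rfl, rfl⟩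

lemma Mem.precomp (h : Mem R x y) (q : B ⟶ A) : Mem R (q ≫ x) (q ≫ y) := by
  rw [Mem, ← prod.comp_lift]
  exact Subobject.factors_of_factors_right q h

lemma mem_of_precomp (q : B ⟶ A) [StrongEpi q] (h : Mem R (q ≫ x) (q ≫ y)) : Mem R x y := by
  rw [Mem, ← prod.comp_lift] at h
  exact factors_of_strongEpi_comp q h

lemma Mem.mono {S : IRel X Y} (h : Mem R x y) (hRS : R ≤ S) : Mem S x y :=
  Subobject.factors_of_le _ hRS h

lemma le_of_forall_mem {R S : IRel X Y}
    (h : ∀ (A : C) (x : A ⟶ X) (y : A ⟶ Y), Mem R x y → Mem S x y) : R ≤ S := by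
  have h_legs : Mem S (leg₁ R) (leg₂ R) := h _ _ _ (mem_iff_exists.mpr ⟨𝟙 _, by simp⟩)
  rw [Mem, lift_legs] at h_legs
  exact Subobject.le_of_factors h_legs

lemma eq_of_forall_mem_iff {R S : IRel X Y}
    (h : ∀ (A : C) (x : A ⟶ X) (y : A ⟶ Y), Mem R x y ↔ Mem S x y) : R = S :=
  le_antisymm (le_of_forall_mem fun A x y => (h A x y).mp)
    (le_of_forall_mem fun A x y => (h A x y).mpr)

lemma mem_inf_iff {S : IRel X Y} : Mem (R ⊓ S) x y ↔ Mem R x y ∧ Mem S x y :=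
  Subobject.inf_factors _

lemma mem_opp_iff : Mem (opp R) y x ↔ Mem R x y := by
  rw [mem_iff_exists (R := R)]
  simp only [Mem, opp, mk_factors_iff_exists, prod.comp_lift, prod_lift_eq_lift_iff, and_comm]

lemma mem_comp_iff {S : IRel Y Z} {z : A ⟶ Z} :
    Mem (comp S R) x z ↔ ∃ (B : C) (q : B ⟶ A) (_ : IsRegularEpi q) (y : B ⟶ Y),
      Mem R (q ≫ x) y ∧ Mem S y (q ≫ z) := by
  simp only [Mem, comp, imageSubobject_factors_iff, prod.comp_lift, prod_lift_eq_lift_iff]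
  refine exists_congr fun B => exists_congr fun q => exists_congr fun _ => ?_
  constructor
  · rintro ⟨k, hx, hz⟩
    refine ⟨k ≫ pullback.fst _ _ ≫ leg₂ R, ?_, ?_⟩
    · rw [← hx]
      exact (mem_precomp_legs _).precomp k
    · rw [← hz, pullback.condition]
      exact (mem_precomp_legs _).precomp k
  · rintro ⟨y, hR, hS⟩
    obtain ⟨f, hfx, hfy⟩ := mem_iff_exists.mp hR
    obtain ⟨g, hgy, hgz⟩ := mem_iff_exists.mp hS
    refine ⟨pullback.lift f g (hfy.trans hgy.symm), ?_, ?_⟩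
    · rw [pullback.lift_fst_assoc, hfx]
    · rw [pullback.lift_snd_assoc, hgz]

end Membership

section Calculus

lemma mem_comp {R : IRel X Y} {S : IRel Y Z} {x : A ⟶ X} {y : A ⟶ Y} {z : A ⟶ Z}
    (hR : Mem R x y) (hS : Mem S y z) : Mem (comp S R) x z :=
  mem_comp_iff.mpr ⟨A, 𝟙 A, inferInstance, y, by simpa using hR, by simpa using hS⟩

lemma comp_le_iff {R : IRel X Y} {S : IRel Y Z} {T : IRel X Z} :
    comp S R ≤ T ↔
      ∀ (A : C) (x : A ⟶ X) (y : A ⟶ Y) (z : A ⟶ Z), Mem R x y → Mem S y z → Mem T x z := by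
  refine ⟨fun h A x y z hR hS => (mem_comp hR hS).mono h, fun h => ?_⟩
  refine le_of_forall_mem fun A x z hxz => ?_
  obtain ⟨B, q, _, y, hR, hS⟩ := mem_comp_iff.mp hxz
  exact mem_of_precomp q (h B _ y _ hR hS)

lemma comp_assoc (T : IRel Z W) (S : IRel Y Z) (R : IRel X Y) :
    comp (comp T S) R = comp T (comp S R) := by
  apply le_antisymm
  · refine comp_le_iff.mpr fun A x y w hR hTS => ?_
    obtain ⟨B, q, _, z, hS, hT⟩ := mem_comp_iff.mp hTS
    exact mem_of_precomp q (mem_comp (mem_comp (hR.precomp q) hS) hT)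
  · refine comp_le_iff.mpr fun A x z w hSR hT => ?_
    obtain ⟨B, q, _, y, hR, hS⟩ := mem_comp_iff.mp hSR
    exact mem_of_precomp q (mem_comp hR (mem_comp hS (hT.precomp q)))

lemma opp_comp (S : IRel Y Z) (R : IRel X Y) : opp (comp S R) = comp (opp R) (opp S) :=
  eq_of_forall_mem_iff fun _ _ _ => by simp only [mem_opp_iff, mem_comp_iff, and_comm]

lemma isRefl_iff {R : IRel X X} : IsRefl R ↔ ∀ (A : C) (x : A ⟶ X), Mem R x x := by
  constructor
  · intro h A x
    refine Subobject.factors_of_le _ h (mk_factors_iff_exists.mpr ⟨x, ?_⟩)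
    rw [prod.comp_lift, Category.comp_id]
  · intro h
    exact Subobject.mk_le_of_comm (R.factorThru _ (h X (𝟙 X))) (R.factorThru_arrow _ _)

lemma isSymm_iff {R : IRel X X} :
    IsSymm R ↔ ∀ (A : C) (x y : A ⟶ X), Mem R x y → Mem R y x :=
  ⟨fun h _ _ _ hxy => (mem_opp_iff.mpr hxy).mono h,
    fun h => le_of_forall_mem fun _ _ _ hxy => h _ _ _ (mem_opp_iff.mp hxy)⟩

lemma isTrans_iff {R : IRel X X} :
    IsTrans R ↔ ∀ (A : C) (x y z : A ⟶ X), Mem R x y → Mem R y z → Mem R x z :=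
  comp_le_iff

lemma IsSymm.opp_eq {R : IRel X X} (hR : IsSymm R) : opp R = R :=
  eq_of_forall_mem_iff fun A x y =>
    mem_opp_iff.trans ⟨isSymm_iff.mp hR A y x, isSymm_iff.mp hR A x y⟩

lemma IsTrans.comp_self {R : IRel X X} (hR : IsTrans R) (hR' : IsRefl R) : comp R R = R :=
  le_antisymm hR (le_of_forall_mem fun A x _ hxy => mem_comp (isRefl_iff.mp hR' A x) hxy)

protected lemma IsRefl.opp {E : IRel X X} (hE : IsRefl E) : IsRefl (opp E) :=
  isRefl_iff.mpr fun A x => mem_opp_iff.mpr (isRefl_iff.mp hE A x)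

protected lemma IsRefl.comp {R S : IRel X X} (hS : IsRefl S) (hR : IsRefl R) : IsRefl (comp S R) :=
  isRefl_iff.mpr fun A x => mem_comp (isRefl_iff.mp hR A x) (isRefl_iff.mp hS A x)

lemma IsRefl.le_opp_comp {E : IRel X X} (hE : IsRefl E) : E ≤ comp (opp E) E :=
  le_of_forall_mem fun A _ y hxy => mem_comp hxy (mem_opp_iff.mpr (isRefl_iff.mp hE A y))

end Calculus

section KernelPair

/-- The kernel pair of a morphism `f`, as an internal relation: `x` and `y` are related when
`x ≫ f = y ≫ f`. It is encoded as the equalizer of `prod.fst ≫ f` and `prod.snd ≫ f`. -/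
noncomputable def kernelRel (f : X ⟶ Y) : IRel X X :=
  equalizerSubobject (prod.fst ≫ f) (prod.snd ≫ f)

lemma mem_kernelRel_iff {f : X ⟶ Y} {x y : A ⟶ X} : Mem (kernelRel f) x y ↔ x ≫ f = y ≫ f := by
  rw [Mem, kernelRel, equalizerSubobject_factors_iff, prod.lift_fst_assoc, prod.lift_snd_assoc]

lemma isEquivRel_kernelRel (f : X ⟶ Y) : IsEquivRel (kernelRel f) where
  refl := isRefl_iff.mpr fun _ _ => mem_kernelRel_iff.mpr rfl
  symm := isSymm_iff.mpr fun _ _ _ h => mem_kernelRel_iff.mpr (mem_kernelRel_iff.mp h).symm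
  trans := isTrans_iff.mpr fun _ _ _ _ h h' =>
    mem_kernelRel_iff.mpr ((mem_kernelRel_iff.mp h).trans (mem_kernelRel_iff.mp h'))

lemma mem_opp_comp_of_mem_kernelRel_comp {R : IRel X Y} {a b : A ⟶ (R : C)}
    (h : Mem (comp (kernelRel (leg₁ R)) (comp (kernelRel (leg₂ R)) (kernelRel (leg₁ R)))) a b) :
    Mem (comp (opp R) R) (a ≫ leg₁ R) (b ≫ leg₁ R) := by
  obtain ⟨B, q, _, d, had, hdb⟩ := mem_comp_iff.mp h
  obtain ⟨B', q', _, c, hac, hcd⟩ := mem_comp_iff.mp had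
  simp only [mem_kernelRel_iff, Category.assoc] at hac hcd hdb
  have ha : Mem R (q' ≫ q ≫ a ≫ leg₁ R) (c ≫ leg₂ R) := hac ▸ mem_precomp_legs c
  have hb : Mem R (q' ≫ q ≫ b ≫ leg₁ R) (c ≫ leg₂ R) := by
    rw [hcd, ← hdb]
    exact (mem_precomp_legs d).precomp q'
  exact mem_of_precomp q (mem_of_precomp q' (mem_comp ha (mem_opp_iff.mpr hb)))

end KernelPair

section Goursat

lemma IsGoursat.mem_opp_comp_of_zigzag (h : IsGoursat C) {R : IRel X Y} {x y z : A ⟶ X}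
    {a b : A ⟶ Y} (hxa : Mem R x a) (hya : Mem R y a) (hyb : Mem R y b) (hzb : Mem R z b) :
    Mem (comp (opp R) R) x z := by
  obtain ⟨xa, rfl, hxa₂⟩ := mem_iff_exists.mp hxa
  obtain ⟨ya, hya₁, hya₂⟩ := mem_iff_exists.mp hya
  obtain ⟨yb, hyb₁, hyb₂⟩ := mem_iff_exists.mp hyb
  obtain ⟨zb, rfl, hzb₂⟩ := mem_iff_exists.mp hzb
  apply mem_opp_comp_of_mem_kernelRel_comp
  rw [h _ _ _ (isEquivRel_kernelRel _) (isEquivRel_kernelRel _)]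
  exact mem_comp (mem_comp (mem_kernelRel_iff.mpr (hxa₂.trans hya₂.symm))
    (mem_kernelRel_iff.mpr (hya₁.trans hyb₁.symm))) (mem_kernelRel_iff.mpr (hyb₂.trans hzb₂.symm))

lemma IsGoursat.comp_opp_le (h : IsGoursat C) {E : IRel X X} (hE : IsRefl E) :
    comp E (opp E) ≤ comp (opp E) E :=
  comp_le_iff.mpr fun A x _ y hzx hzy =>
    h.mem_opp_comp_of_zigzag (isRefl_iff.mp hE A x) (mem_opp_iff.mp hzx) hzy (isRefl_iff.mp hE A y)

lemma IsEquivRel.comp_comp_le_of_comp_opp_le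
    {R S : IRel X X} (hR : IsEquivRel R) (hS : IsEquivRel S)
    (h : comp (comp R S) (opp (comp R S)) ≤ comp (opp (comp R S)) (comp R S)) :
    comp R (comp S R) ≤ comp S (comp R S) := by
  have opp_comp_eq : opp (comp R S) = comp S R := by
    rw [opp_comp, hR.symm.opp_eq, hS.symm.opp_eq]
  calc comp R (comp S R)
      = comp R (comp (comp S S) R) := by rw [hS.trans.comp_self hS.refl]
    _ = comp (comp R S) (opp (comp R S)) := by simp only [opp_comp_eq, comp_assoc]
    _ ≤ comp (opp (comp R S)) (comp R S) := h
    _ = comp S (comp (comp R R) S) := by simp only [opp_comp_eq, comp_assoc]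
    _ = comp S (comp R S) := by rw [hR.trans.comp_self hR.refl]

theorem isGoursat_iff_comp_opp_le :
    IsGoursat C ↔ ∀ (X : C) (E : IRel X X), IsRefl E → comp E (opp E) ≤ comp (opp E) E := by
  refine ⟨fun h _ _ hE => h.comp_opp_le hE, fun h X R S hR hS => le_antisymm ?_ ?_⟩
  · exact hR.comp_comp_le_of_comp_opp_le hS (h X _ (hR.refl.comp hS.refl))
  · exact hS.comp_comp_le_of_comp_opp_le hR (h X _ (hS.refl.comp hR.refl))

lemma ShiftingForReflDiagram.comp_opp_le (h : ShiftingForReflDiagram C) {E : IRel X X}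
    (hE : IsRefl E) : comp E (opp E) ≤ comp (opp E) E := by
  refine comp_le_iff.mpr fun A x z y hzx hzy => ?_
  have hz : Mem (comp E (opp E) ⊓ comp (opp E) E) z z :=
    mem_inf_iff.mpr ⟨isRefl_iff.mp (hE.comp hE.opp) A z, isRefl_iff.mp (hE.opp.comp hE) A z⟩
  exact h X E hE A z x y (inf_le_right.trans hE.le_opp_comp) hz (mem_opp_iff.mp hzx) hzy
    (mem_comp hzx hzy)

end Goursat

end RegularRel

theorem corollary3p7 (C : Type u) [Category.{v} C] [Regular C] :
    List.TFAE [RegularRel.IsGoursat C, RegularRel.ShiftingForReflDiagram C,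
      RegularRel.ShiftingForRefl C] := by
  tfae_have 1 → 3 := fun h X E hE _ _ _ _ _ _ _ _ _ huv =>
    huv.mono (RegularRel.isGoursat_iff_comp_opp_le.mp h X E hE)
  tfae_have 3 → 2 := fun h X E hE A z x y => h X E hE A z z x y
  tfae_have 2 → 1 := fun h =>
    RegularRel.isGoursat_iff_comp_opp_le.mpr fun _ _ hE => h.comp_opp_le hE
  tfae_finish
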